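/- Let $m\ge 1$ and consider the nonlinear equation with distributed delays $$\dot x(t)+f(t,x(t))+\sum_{k=1}^m\int_{[h_k(t),t]} g_k(t,x(s))\,d_sR_k(t,s)=0,\quad t\ge 0,\qquad x(t)=\varphi(t),\quad t\le 0,$$ where the integrals are Lebesgue–Stieltjes integrals. A solution is a function on $\mathbb R$ that equals $\varphi$ on $(-\infty,0]$, is absolutely continuous on every interval $[0,T]$ and satisfies the equation for almost every $t\ge 0$. Assume the following. (i) Each $h_k$ is Lebesgue measurable on $[0,\infty)$, $h_k(t)\le t$, $\lim_{t\to\infty}h_k(t)=\infty$, and $t-h_k(t)\le h_0$ for all $t\ge 0$. (ii) For each $k$ and almost every $t\ge 0$, the function $s\mapsto R_k(t,s)$ is nondecreasing on $\mathbb R$ and the measure $d_sR_k(t,\cdot)$ has mass at most $1$ on $[\max\{0,h_k(t)\},t]$. (This holds in particular if $\int_{[h_k(t),t]}d_sR_k(t,s)=1$, and also if $\int_{[0,t]}d_sR_k(t,s)=1$.) (iii) The functions $f$ and $g_k$ are continuous on $[0,\infty)\times\mathbb R$, $f(t,0)=g_k(t,0)=0$, and $f(t,u)u>0$, $g_k(t,u)u>0$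 for all $t\ge 0$ and $u\ne 0$. (iv) There are $-\infty\le x_1^0\le 0\le x_2^0\le\infty$ and $-\infty<x_1\le 0\le x_2<\infty$ such that for every bounded continuous $\varphi:(-\infty,0]\to\mathbb R$ with $x_1^0\le\varphi\le x_2^0$ the problem has a unique global solution $x$, and $x_1\le x(t)\le x_2$ for all sufficiently large $t$ (in particular, this is so if these bounds hold for all $t\ge 0$). (v) There are positive numbers $a_0,A,b_1,\dots,b_m$ such that for all $t\ge0$, all $k$ and all $u\in[x_1,x_2]$, $u\ne 0$, $$a_0\le\frac{f(t,u)}{u}\le A,\qquad 0\le\frac{g_k(t,u)}{u}\le b_k,$$ and, with $b_0=\sum_{k=1}^m b_k$, $$\frac{a_0}{b_0}e^{-Ah_0}>\ln\frac{b_0^2+a_0b_0}{b_0^2+a_0^2}.$$ Then for every bounded continuous $\varphi:(-\infty,0]\to\mathbb R$ with $x_1^0\le\varphi\le x_2^0$, every solution $x$ of the problem satisfies $\lim_{t\to\infty}x(t)=0$. -/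

import Mathlib

open MeasureTheory Set Filter Topology

/-- The Lebesgue-Stieltjes measure `d r` of a nondecreasing function `r : ℝ → ℝ`, so that
`d r [a, b] = r (b+) - r (a-)`. (It is set to `0` if `r` is not nondecreasing.) -/
noncomputable def lebesgueStieltjes (r : ℝ → ℝ) : Measure ℝ :=
  open Classical in if hr : Monotone r then hr.stieltjesFunction.measure else 0

/-- `h` is a delayed argument on `[0, ∞)`: it is Lebesgue measurable there, `h t ≤ t`,
and `h t → ∞` as `t → ∞`. -/
structure IsDelayedArgument (h : ℝ → ℝ) : Prop where
  measurable : AEMeasurable h (volume.restrict (Ici 0))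
  le_self : ∀ t, 0 ≤ t → h t ≤ t
  tendsto : Tendsto h atTop atTop

/-- The nonlinearity `f (t, u)`, `t ≥ 0`, `u ∈ ℝ`, is continuous, vanishes at `u = 0` and has
the sign of `u`. -/
structure IsSignPreserving (f : ℝ → ℝ → ℝ) : Prop where
  continuousOn : ContinuousOn (fun p : ℝ × ℝ => f p.1 p.2) (Ici 0 ×ˢ univ)
  zero : ∀ t, 0 ≤ t → f t 0 = 0
  pos : ∀ t, 0 ≤ t → ∀ u, u ≠ 0 → 0 < f t u * u

/-- Admissible initial functions: bounded continuous `φ` on `(-∞, 0]` with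
`lo ≤ φ ≤ hi`, where `lo` and `hi` may be infinite. Values of `φ` on `(0, ∞)` play no role. -/
structure IsAdmissibleInitial (lo hi : EReal) (φ : ℝ → ℝ) : Prop where
  continuousOn : ContinuousOn φ (Iic 0)
  bounded : ∃ C : ℝ, ∀ t, t ≤ 0 → |φ t| ≤ C
  mem_range : ∀ t, t ≤ 0 → lo ≤ (φ t : EReal) ∧ (φ t : EReal) ≤ hi

/-- `x` is a global solution of
`x'(t) + f (t, x t) + ∑ k, ∫_{[h k t, t]} g k (t, x s) d_s R k (t, s) = 0` for `t ≥ 0`,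
with `x t = φ t` for `t ≤ 0`: it is absolutely continuous on every interval `[0, T]`
and satisfies the equation almost everywhere. -/
structure IsSolution {m : ℕ} (f : ℝ → ℝ → ℝ) (g : Fin m → ℝ → ℝ → ℝ) (h : Fin m → ℝ → ℝ)
    (R : Fin m → ℝ → ℝ → ℝ) (φ x : ℝ → ℝ) : Prop where
  initial : ∀ t, t ≤ 0 → x t = φ t
  absolutelyContinuous : ∀ T, 0 ≤ T → AbsolutelyContinuousOnInterval x 0 T
  equation : ∀ᵐ t ∂(volume.restrict (Ici (0 : ℝ))), ∃ x' : ℝ, HasDerivAt x x' t ∧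
    x' + f t (x t)
      + ∑ k, ∫ s in Icc (h k t) t, g k t (x s) ∂(lebesgueStieltjes (R k t)) = 0

/-!
Let `a t = f (t, x t) / x t`, so that `x' = -a x - F` with the delayed term `F`, and measure time
by `τ = ∫ a`. A solution of constant sign is eventually dominated by a multiple of `e ^ (-τ)`.
An oscillating solution is compared, on a hump `[s, t]` that starts at a zero `s`, with linear
equations: if `-m ≤ x` and `β = b₀ / a₀`, the Yorke bound on `F` gives
`x r ≤ β m (1 - e ^ (-(τ r - τ s)))` after `s` and `x u ≥ -β m (e ^ (τ s - τ u) - 1)` before `s`.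
A delay takes at most the internal time `H = A h₀`, so when `τ r - τ s > H - log (1 + 1 / β)` the
second bound improves on `-m` throughout the memory of `r`, and inserting it into the equation
yields `x t ≤ K m` with `K = (β² + β) exp (-e ^ (-H) / β) - β²`. The logarithmic condition says
exactly that `K < 1`. It still holds when `H` is enlarged to `log (1 + 1 / β)`, which ensures that
the first phase of a hump is not void. Iterating on later and later zeros gives `x → 0`.
-/

/-- The factor by which a bound on an oscillating solution contracts after a zero, when `β` is the
strength of the delayed term relative to the instantaneous one and `H` bounds the delay measured in
internal time. -/
noncomputable def yorkeContraction (β H : ℝ) : ℝ :=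
  (β ^ 2 + β) * Real.exp (-(Real.exp (-H) / β)) - β ^ 2

theorem mul_one_sub_exp_neg_le_yorkeContraction {β H σ : ℝ} (hβ : 0 < β)
    (hσ : σ ≤ H - Real.log (1 + β⁻¹)) :
    β * (1 - Real.exp (-σ)) ≤ yorkeContraction β H := by
  have hexp : Real.exp (-(H - Real.log (1 + β⁻¹))) = (1 + β) * (Real.exp (-H) / β) := by
    rw [neg_sub, sub_eq_add_neg, Real.exp_add, Real.exp_log (by positivity)]
    field_simp
    ring
  have hexp_le : (1 + β) * (Real.exp (-H) / β) ≤ Real.exp (-σ) :=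
    hexp ▸ Real.exp_le_exp.2 (neg_le_neg hσ)
  have htangent := Real.add_one_le_exp (-(Real.exp (-H) / β))
  calc β * (1 - Real.exp (-σ)) ≤ β * (1 - (1 + β) * (Real.exp (-H) / β)) := by gcongr
    _ = (β ^ 2 + β) * (-(Real.exp (-H) / β) + 1) - β ^ 2 := by ring
    _ ≤ yorkeContraction β H := by unfold yorkeContraction; gcongr

theorem yorkeContraction_nonneg {β H : ℝ} (hβ : 0 < β) (hH : Real.log (1 + β⁻¹) ≤ H) :
    0 ≤ yorkeContraction β H := by
  simpa using mul_one_sub_exp_neg_le_yorkeContraction hβ (sub_nonneg.2 hH)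

theorem yorkeContraction_lt_one {β H : ℝ} (hβ : 0 < β)
    (hH : Real.log ((β ^ 2 + β) / (β ^ 2 + 1)) < Real.exp (-H) / β) :
    yorkeContraction β H < 1 := by
  rw [Real.log_lt_iff_lt_exp (by positivity), div_lt_iff₀ (by positivity)] at hH
  rw [yorkeContraction, Real.exp_neg, ← div_eq_mul_inv, sub_lt_iff_lt_add,
    div_lt_iff₀ (Real.exp_pos _)]
  linarith

theorem log_lt_exp_neg_max_div {β D : ℝ} (hβ : 0 < β)
    (hD : Real.log ((β ^ 2 + β) / (β ^ 2 + 1)) < Real.exp (-D) / β) :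
    Real.log ((β ^ 2 + β) / (β ^ 2 + 1)) < Real.exp (-max D (Real.log (1 + β⁻¹))) / β := by
  rcases max_choice D (Real.log (1 + β⁻¹)) with hmax | hmax
  · rwa [hmax]
  · rw [hmax, Real.exp_neg, Real.exp_log (by positivity)]
    calc Real.log ((β ^ 2 + β) / (β ^ 2 + 1)) ≤ (β ^ 2 + β) / (β ^ 2 + 1) - 1 :=
          Real.log_le_sub_one_of_pos (by positivity)
      _ = (β - 1) / (β ^ 2 + 1) := by field_simp; ring
      _ < 1 / (β + 1) := by
          rw [div_lt_div_iff₀ (by positivity) (by positivity)]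
          linarith
      _ = (1 + β⁻¹)⁻¹ / β := by field_simp

theorem tendsto_zero_of_eventually_norm_le_mul {α E : Type*} [SeminormedAddCommGroup E]
    {l : Filter α} {x : α → E} {K M : ℝ} (hK₀ : 0 ≤ K) (hK₁ : K < 1)
    (hM : ∀ᶠ t in l, ‖x t‖ ≤ M)
    (hstep : ∀ m, (∀ᶠ t in l, ‖x t‖ ≤ m) → ∀ᶠ t in l, ‖x t‖ ≤ K * m) :
    Tendsto x l (𝓝 0) := by
  have hiter (n : ℕ) : ∀ᶠ t in l, ‖x t‖ ≤ K ^ n * M := by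
    induction n with
    | zero => simpa using hM
    | succ n ih => simpa only [pow_succ', mul_assoc] using hstep _ ih
  have hlim : Tendsto (fun n : ℕ => K ^ n * M) atTop (𝓝 0) := by
    simpa using (tendsto_pow_atTop_nhds_zero_of_lt_one hK₀ hK₁).mul_const M
  refine tendsto_zero_iff_norm_tendsto_zero.2 (tendsto_order.2
    ⟨fun c hc => .of_forall fun t => hc.trans_le (norm_nonneg _), fun c hc => ?_⟩)
  obtain ⟨n, hn⟩ := (hlim.eventually_lt_const hc).exists
  filter_upwards [hiter n] with t ht using ht.trans_lt hn

theorem eventually_pos_or_eventually_neg_or_frequently_eq_zero {x : ℝ → ℝ} {T : ℝ}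
    (hx : ContinuousOn x (Ici T)) :
    (∀ᶠ t in atTop, 0 < x t) ∨ (∀ᶠ t in atTop, x t < 0) ∨ ∃ᶠ t in atTop, x t = 0 := by
  by_contra! hcon
  obtain ⟨hpos, hneg, hzero⟩ := hcon
  obtain ⟨N, hN⟩ := eventually_atTop.1 hzero
  obtain ⟨s, hs, hxs⟩ := frequently_atTop.1 hpos (max T N)
  obtain ⟨t, ht, hxt⟩ := frequently_atTop.1 hneg (max T N)
  obtain ⟨z, hz, hxz⟩ := isPreconnected_Ici.intermediate_value hs ht
    (hx.mono (Ici_subset_Ici.2 (le_max_left T N))) ⟨hxs, hxt⟩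
  exact hN z ((le_max_right T N).trans hz) hxz

theorem exists_eq_zero_forall_Icc_nonneg {x : ℝ → ℝ} {s₀ t : ℝ} (hst : s₀ ≤ t)
    (hx : ContinuousOn x (Icc s₀ t)) (hs₀ : x s₀ = 0) (ht : 0 < x t) :
    ∃ s ∈ Icc s₀ t, x s = 0 ∧ ∀ u ∈ Icc s t, 0 ≤ x u := by
  obtain ⟨s, ⟨hs, hxs⟩, hlast⟩ : ∃ s, IsGreatest (Icc s₀ t ∩ x ⁻¹' {0}) s :=
    (isCompact_Icc.of_isClosed_subset
      (hx.preimage_isClosed_of_isClosed isClosed_Icc isClosed_singleton)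
      inter_subset_left).exists_isGreatest ⟨s₀, ⟨le_rfl, hst⟩, hs₀⟩
  refine ⟨s, hs, hxs, fun u hu => ?_⟩
  by_contra! hneg
  obtain ⟨z, hz, hxz⟩ := intermediate_value_Icc hu.2
    (hx.mono (Icc_subset_Icc_left (hs.1.trans hu.1))) ⟨hneg.le, ht.le⟩
  have hzs : z ≤ s := hlast ⟨⟨hs.1.trans (hu.1.trans hz.1), hz.2⟩, hxz⟩
  obtain rfl : u = s := le_antisymm (hz.1.trans hzs) hu.1
  exact hneg.ne hxs

theorem absolutelyContinuousOnInterval_comp_of_lipschitzOnWith {X Y : Type*}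
    [PseudoMetricSpace X] [PseudoMetricSpace Y] {φ : X → Y} {f : ℝ → X} {K : NNReal} {s t : ℝ}
    (hφ : LipschitzOnWith K φ (f '' uIcc s t)) (hf : AbsolutelyContinuousOnInterval f s t) :
    AbsolutelyContinuousOnInterval (φ ∘ f) s t := by
  have hlim := Tendsto.const_mul (K : ℝ) hf
  rw [mul_zero] at hlim
  refine squeeze_zero' (.of_forall fun E => Finset.sum_nonneg fun i _ => dist_nonneg) ?_ hlim
  filter_upwards [mem_inf_of_right (mem_principal_self _)] with E hE
  rw [Finset.mul_sum]
  exact Finset.sum_le_sum fun i hi => hφ.dist_le_mul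
    _ (mem_image_of_mem f (hE.1 i hi).1) _ (mem_image_of_mem f (hE.1 i hi).2)

theorem absolutelyContinuousOnInterval_exp_comp {f : ℝ → ℝ} {s t : ℝ}
    (hf : AbsolutelyContinuousOnInterval f s t) :
    AbsolutelyContinuousOnInterval (Real.exp ∘ f) s t := by
  obtain ⟨c, d, himage⟩ : ∃ c d, f '' uIcc s t ⊆ Icc c d :=
    ⟨_, _, (isCompact_uIcc.image_of_continuousOn hf.continuousOn).isBounded.subset_Icc_sInf_sSup⟩
  obtain ⟨K, hK⟩ := (Real.contDiff_exp (n := 1)).contDiffOn.exists_lipschitzOnWith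
    (by decide) (convex_Icc c d) isCompact_Icc
  exact absolutelyContinuousOnInterval_comp_of_lipschitzOnWith (hK.mono himage) hf

theorem le_of_absolutelyContinuousOnInterval_of_ae_deriv_nonpos {w : ℝ → ℝ} {s t : ℝ}
    (hst : s ≤ t) (hw : AbsolutelyContinuousOnInterval w s t)
    (hderiv : ∀ᵐ r, r ∈ Icc s t → deriv w r ≤ 0) : w t ≤ w s := by
  rw [← sub_nonpos, ← hw.integral_deriv_eq_sub, intervalIntegral.integral_of_le hst]
  refine setIntegral_nonpos_ae measurableSet_Ioc ?_
  filter_upwards [hderiv] with r hr hmem using hr (Ioc_subset_Icc_self hmem)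

theorem continuousOn_Ici_of_absolutelyContinuousOnInterval {E : Type*}
    [SeminormedAddCommGroup E] {x : ℝ → E} {T : ℝ}
    (hx : ∀ t, T ≤ t → AbsolutelyContinuousOnInterval x T t) :
    ContinuousOn x (Ici T) := by
  intro t ht
  have hcont := (hx (t + 1) (by linarith [mem_Ici.1 ht])).continuousOn
  rw [uIcc_of_le (by linarith [mem_Ici.1 ht])] at hcont
  refine (hcont t ⟨ht, by linarith⟩).mono_of_mem_nhdsWithin ?_
  rw [← Ici_inter_Iic]
  exact inter_mem_nhdsWithin _ (Iic_mem_nhds (lt_add_one t))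

/-- The comparison principle: `x` stays below the solution of
`y' + τ' y = τ' (p + q e ^ (-(τ - τ s)))` with the same initial value at `s`. -/
theorem le_add_mul_exp_of_ae_deriv_le {τ x : ℝ → ℝ} {p q s t : ℝ} (hst : s ≤ t)
    (hτ : AbsolutelyContinuousOnInterval τ s t) (hx : AbsolutelyContinuousOnInterval x s t)
    (hderiv : ∀ᵐ r, r ∈ Icc s t →
      deriv x r ≤ deriv τ r * (p + q * Real.exp (-(τ r - τ s)) - x r)) :
    x t ≤ p + (x s - p + q * (τ t - τ s)) * Real.exp (-(τ t - τ s)) := by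
  have hconst (c : ℝ) : AbsolutelyContinuousOnInterval (fun _ => c) s t :=
    (LipschitzWith.const c).lipschitzOnWith.absolutelyContinuousOnInterval
  have hδ : AbsolutelyContinuousOnInterval (fun r => τ r - τ s) s t := hτ.sub (hconst _)
  have hw := ((absolutelyContinuousOnInterval_exp_comp hδ).mul (hx.sub (hconst p))).sub
    (hδ.const_mul q)
  have hle := le_of_absolutelyContinuousOnInterval_of_ae_deriv_nonpos hst hw <| by
    filter_upwards [hτ.ae_differentiableAt, hx.ae_differentiableAt, hderiv]
      with r hτr hxr hr hmem
    have hmem' : r ∈ uIcc s t := Icc_subset_uIcc hmem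
    have hδr := (hτr hmem').hasDerivAt.sub_const (τ s)
    refine ((hδr.exp.mul ((hxr hmem').hasDerivAt.sub_const p)).sub
      (hδr.const_mul q)).deriv.trans_le ?_
    have hmul := mul_le_mul_of_nonneg_left (hr hmem) (Real.exp_pos (τ r - τ s)).le
    have hcancel : Real.exp (τ r - τ s) * Real.exp (-(τ r - τ s)) = 1 := by
      rw [← Real.exp_add, add_neg_cancel, Real.exp_zero]
    linear_combination hmul + deriv τ r * q * hcancel
  simp only [Pi.sub_apply, Pi.mul_apply, Function.comp_apply, sub_self, Real.exp_zero, one_mul,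
    mul_zero, sub_zero] at hle
  calc x t = p + Real.exp (τ t - τ s) * (x t - p) * Real.exp (-(τ t - τ s)) := by
        rw [mul_right_comm, ← Real.exp_add, add_neg_cancel, Real.exp_zero]; ring
    _ ≤ p + (x s - p + q * (τ t - τ s)) * Real.exp (-(τ t - τ s)) := by
        gcongr; linarith

/-- On `[T₀, ∞)` the function `x` behaves like a solution of `x' = -τ' x - F` whose delayed term
satisfies the Yorke condition `-β τ' sup (-x)⁺ ≤ F ≤ β τ' sup x⁺`, the suprema being taken over the
memory `[t - h₀, t]`. The nondecreasing function `τ` is the internal time of the equation. The term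
`F` is eliminated: the condition is imposed on `x'`, with an arbitrary bound `c` for the
supremum. -/
structure IsYorkeControlled (τ x : ℝ → ℝ) (β h₀ T₀ : ℝ) : Prop where
  delay_nonneg : 0 ≤ h₀
  time_mono : MonotoneOn τ (Ici T₀)
  time_absolutelyContinuous : ∀ t, T₀ ≤ t → AbsolutelyContinuousOnInterval τ T₀ t
  absolutelyContinuous : ∀ t, T₀ ≤ t → AbsolutelyContinuousOnInterval x T₀ t
  deriv_le : ∀ᵐ t, T₀ + h₀ ≤ t → ∀ c, 0 ≤ c → (∀ u ∈ Icc (t - h₀) t, -c ≤ x u) →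
    deriv x t ≤ deriv τ t * (β * c - x t)
  le_deriv : ∀ᵐ t, T₀ + h₀ ≤ t → ∀ c, 0 ≤ c → (∀ u ∈ Icc (t - h₀) t, x u ≤ c) →
    deriv τ t * (-(β * c) - x t) ≤ deriv x t

namespace IsYorkeControlled

variable {τ x : ℝ → ℝ} {β h₀ T₀ : ℝ}

theorem neg (hx : IsYorkeControlled τ x β h₀ T₀) :
    IsYorkeControlled τ (fun t => -x t) β h₀ T₀ where
  delay_nonneg := hx.delay_nonneg
  time_mono := hx.time_mono
  time_absolutelyContinuous := hx.time_absolutelyContinuous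
  absolutelyContinuous t ht := (hx.absolutelyContinuous t ht).neg
  deriv_le := by
    filter_upwards [hx.le_deriv] with t ht hTt c hc hxc
    rw [deriv.fun_neg]
    linarith [ht hTt c hc fun u hu => neg_le_neg_iff.1 (hxc u hu)]
  le_deriv := by
    filter_upwards [hx.deriv_le] with t ht hTt c hc hxc
    rw [deriv.fun_neg]
    linarith [ht hTt c hc fun u hu => neg_le.1 (hxc u hu)]

theorem mono (hx : IsYorkeControlled τ x β h₀ T₀) {T : ℝ} (hT : T₀ ≤ T) :
    IsYorkeControlled τ x β h₀ T := by
  have hsub (t : ℝ) (ht : T ≤ t) : uIcc T t ⊆ uIcc T₀ t :=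
    uIcc_subset_uIcc_right (by rw [uIcc_of_le (hT.trans ht)]; exact ⟨hT, ht⟩)
  refine ⟨hx.delay_nonneg, hx.time_mono.mono (Ici_subset_Ici.2 hT),
    fun t ht => (hx.time_absolutelyContinuous t (hT.trans ht)).mono (hsub t ht),
    fun t ht => (hx.absolutelyContinuous t (hT.trans ht)).mono (hsub t ht), ?_, ?_⟩
  · filter_upwards [hx.deriv_le] with t ht hTt using ht (by linarith)
  · filter_upwards [hx.le_deriv] with t ht hTt using ht (by linarith)

theorem continuousOn (hx : IsYorkeControlled τ x β h₀ T₀) : ContinuousOn x (Ici T₀) :=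
  continuousOn_Ici_of_absolutelyContinuousOnInterval hx.absolutelyContinuous

theorem time_continuousOn (hx : IsYorkeControlled τ x β h₀ T₀) : ContinuousOn τ (Ici T₀) :=
  continuousOn_Ici_of_absolutelyContinuousOnInterval hx.time_absolutelyContinuous

theorem le_add_mul_exp (hx : IsYorkeControlled τ x β h₀ T₀) {p q s t : ℝ} (hs : T₀ + h₀ ≤ s)
    (hst : s ≤ t) (hpq : ∀ r ∈ Icc s t, 0 ≤ p + q * Real.exp (-(τ r - τ s)))
    (hlow : ∀ r ∈ Icc s t, ∀ u ∈ Icc (r - h₀) r, -(p + q * Real.exp (-(τ r - τ s))) ≤ x u) :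
    x t ≤ β * p + (x s - β * p + β * q * (τ t - τ s)) * Real.exp (-(τ t - τ s)) := by
  have hT₀s : T₀ ≤ s := by linarith [hx.delay_nonneg]
  have hsub : uIcc s t ⊆ uIcc T₀ t :=
    uIcc_subset_uIcc_right (by rw [uIcc_of_le (hT₀s.trans hst)]; exact ⟨hT₀s, hst⟩)
  refine le_add_mul_exp_of_ae_deriv_le hst
    ((hx.time_absolutelyContinuous t (hT₀s.trans hst)).mono hsub)
    ((hx.absolutelyContinuous t (hT₀s.trans hst)).mono hsub) ?_
  filter_upwards [hx.deriv_le] with r hr hmem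
  simpa only [mul_add, mul_assoc] using
    hr (hs.trans hmem.1) _ (hpq r hmem) (hlow r hmem)

theorem le_mul_exp_of_nonneg (hx : IsYorkeControlled τ x β h₀ T₀) {s t : ℝ} (hs : T₀ + h₀ ≤ s)
    (hst : s ≤ t) (hnonneg : ∀ u ∈ Icc (s - h₀) t, 0 ≤ x u) :
    x t ≤ x s * Real.exp (-(τ t - τ s)) := by
  simpa using hx.le_add_mul_exp (p := 0) (q := 0) hs hst (by simp) fun r hr u hu => by
    simpa using hnonneg u ⟨by linarith [hr.1, hu.1], hu.2.trans hr.2⟩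

theorem le_of_nonneg (hx : IsYorkeControlled τ x β h₀ T₀) {s t : ℝ} (hs : T₀ + h₀ ≤ s)
    (hst : s ≤ t) (hnonneg : ∀ u ∈ Icc (s - h₀) t, 0 ≤ x u) : x t ≤ x s := by
  have hh₀ := hx.delay_nonneg
  have hτ : τ s ≤ τ t := hx.time_mono (mem_Ici.2 (by linarith)) (mem_Ici.2 (by linarith)) hst
  exact (hx.le_mul_exp_of_nonneg hs hst hnonneg).trans
    (mul_le_of_le_one_right (hnonneg s ⟨by linarith, hst⟩) (Real.exp_le_one_iff.2 (by linarith)))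

theorem tendsto_zero_of_eventually_nonneg (hx : IsYorkeControlled τ x β h₀ T₀)
    (hτ : Tendsto τ atTop atTop) (hnonneg : ∀ᶠ t in atTop, 0 ≤ x t) : Tendsto x atTop (𝓝 0) := by
  obtain ⟨N, hN⟩ := eventually_atTop.1 hnonneg
  set s := max T₀ N + h₀
  have hlim : Tendsto (fun t => x s * Real.exp (-(τ t - τ s))) atTop (𝓝 0) := by
    simpa [sub_eq_add_neg] using (Real.tendsto_exp_neg_atTop_nhds_zero.comp
      (tendsto_atTop_add_const_right _ (-τ s) hτ)).const_mul (x s)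
  refine squeeze_zero' hnonneg ?_ hlim
  filter_upwards [eventually_ge_atTop s] with t ht
  exact hx.le_mul_exp_of_nonneg (by linarith [le_max_left T₀ N]) ht
    fun u hu => hN u (by linarith [hu.1, le_max_right T₀ N])

section Hump

variable {m s t H : ℝ}

theorem le_after_zero (hx : IsYorkeControlled τ x β h₀ T₀) (hm : 0 ≤ m)
    (hlow : ∀ u, T₀ ≤ u → -m ≤ x u) (hs : T₀ + h₀ ≤ s) (hxs : x s = 0) (hst : s ≤ t) :
    x t ≤ β * m * (1 - Real.exp (-(τ t - τ s))) := by
  have hle := hx.le_add_mul_exp (p := m) (q := 0) hs hst (fun _ _ => by simpa using hm)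
    fun r hr u hu => by simpa using hlow u (by linarith [hr.1, hu.1])
  rw [hxs] at hle
  linarith

theorem le_before_zero (hx : IsYorkeControlled τ x β h₀ T₀) (hm : 0 ≤ m)
    (hlow : ∀ u, T₀ ≤ u → -m ≤ x u) (ht : T₀ + h₀ ≤ t) (hts : t ≤ s) (hxs : x s = 0) :
    -(β * m * (Real.exp (τ s - τ t) - 1)) ≤ x t := by
  have hle := hx.le_add_mul_exp (p := m) (q := 0) ht hts (fun _ _ => by simpa using hm)
    fun r hr u hu => by simpa using hlow u (by linarith [hr.1, hu.1])
  rw [hxs, Real.exp_neg, ← div_eq_mul_inv, ← sub_le_iff_le_add',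
    le_div_iff₀ (Real.exp_pos _)] at hle
  linarith

theorem neg_le_of_hump (hx : IsYorkeControlled τ x β h₀ T₀) (hβ : 0 < β) (hm : 0 ≤ m)
    (hlow : ∀ u, T₀ ≤ u → -m ≤ x u) (hH : ∀ r, T₀ + h₀ ≤ r → τ r - τ (r - h₀) ≤ H)
    (hs : T₀ + 2 * h₀ ≤ s) (hxs : x s = 0) (hnonneg : ∀ u ∈ Icc s t, 0 ≤ x u) {r : ℝ} (hsr : s ≤ r)
    (hrt : r ≤ t) (hr : r ≤ s + h₀) :
    0 ≤ β * m * (Real.exp (H - (τ r - τ s)) - 1) ∧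
      ∀ u ∈ Icc (r - h₀) r, -(β * m * (Real.exp (H - (τ r - τ s)) - 1)) ≤ x u := by
  have hh₀ := hx.delay_nonneg
  have hdelay : ∀ u ∈ Icc (r - h₀) r, τ r - τ u ≤ H := fun u hu => by
    have hτu : τ (r - h₀) ≤ τ u :=
      hx.time_mono (mem_Ici.2 (by linarith)) (mem_Ici.2 (by linarith [hu.1])) hu.1
    linarith [hH r (by linarith [hh₀])]
  have hbound : 0 ≤ β * m * (Real.exp (H - (τ r - τ s)) - 1) :=
    mul_nonneg (mul_nonneg hβ.le hm) (sub_nonneg.2 (Real.one_le_exp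
      (sub_nonneg.2 (hdelay s ⟨by linarith, hsr⟩))))
  refine ⟨hbound, fun u hu => ?_⟩
  rcases le_total s u with hsu | hus
  · exact (neg_nonpos.2 hbound).trans (hnonneg u ⟨hsu, hu.2.trans hrt⟩)
  · have hexp : Real.exp (τ s - τ u) ≤ Real.exp (H - (τ r - τ s)) :=
      Real.exp_le_exp.2 (by linarith [hdelay u hu])
    refine le_trans ?_ (hx.le_before_zero hm hlow (by linarith [hu.1]) hus hxs)
    gcongr

theorem le_of_hump (hx : IsYorkeControlled τ x β h₀ T₀) (hβ : 0 < β) (hm : 0 ≤ m)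
    (hlow : ∀ u, T₀ ≤ u → -m ≤ x u) (hH : ∀ r, T₀ + h₀ ≤ r → τ r - τ (r - h₀) ≤ H)
    (hs : T₀ + 2 * h₀ ≤ s) (hxs : x s = 0) (hnonneg : ∀ u ∈ Icc s t, 0 ≤ x u) {t₁ : ℝ}
    (hst₁ : s ≤ t₁) (ht₁t : t₁ ≤ t) (hts : t ≤ s + h₀) :
    x t ≤ -(β ^ 2 * m) + (x t₁ + β ^ 2 * m + β ^ 2 * m * Real.exp (H - (τ t₁ - τ s))
      * (τ t - τ t₁)) * Real.exp (-(τ t - τ t₁)) := by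
  have hprofile (r : ℝ) : β * m * (Real.exp (H - (τ r - τ s)) - 1) =
      -(β * m) + β * m * Real.exp (H - (τ t₁ - τ s)) * Real.exp (-(τ r - τ t₁)) := by
    rw [mul_assoc (β * m), ← Real.exp_add]
    ring_nf
  have hlow' (r : ℝ) (hr : r ∈ Icc t₁ t) := hx.neg_le_of_hump hβ hm hlow hH hs hxs hnonneg
    (hst₁.trans hr.1) hr.2 (hr.2.trans hts)
  simp only [hprofile] at hlow'
  have hle := hx.le_add_mul_exp (by linarith [hx.delay_nonneg]) ht₁t
    (fun r hr => (hlow' r hr).1) fun r hr => (hlow' r hr).2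
  convert hle using 1
  ring

theorem le_yorkeContraction_mul_of_hump (hx : IsYorkeControlled τ x β h₀ T₀) (hβ : 0 < β)
    (hm : 0 ≤ m) (hlow : ∀ u, T₀ ≤ u → -m ≤ x u)
    (hH : ∀ r, T₀ + h₀ ≤ r → τ r - τ (r - h₀) ≤ H) (hβH : Real.log (1 + β⁻¹) ≤ H)
    (hs : T₀ + 2 * h₀ ≤ s) (hxs : x s = 0) (hnonneg : ∀ u ∈ Icc s t, 0 ≤ x u) (hst : s ≤ t)
    (hts : t ≤ s + h₀) :
    x t ≤ yorkeContraction β H * m := by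
  have hh₀ := hx.delay_nonneg
  have hafter {u : ℝ} (hu : s ≤ u) : x u ≤ β * (1 - Real.exp (-(τ u - τ s))) * m := by
    linarith [hx.le_after_zero hm hlow (by linarith [hh₀]) hxs hu]
  rcases le_or_gt (τ t - τ s) (H - Real.log (1 + β⁻¹)) with hshort | hlong
  · exact (hafter hst).trans (by gcongr; exact mul_one_sub_exp_neg_le_yorkeContraction hβ hshort)
  -- At `t₁` the lower bound of `neg_le_of_hump` equals `-m`; from there on it is the better one.
  obtain ⟨t₁, ⟨hst₁, ht₁t⟩, hτt₁⟩ : ∃ t₁ ∈ Icc s t, τ t₁ = τ s + (H - Real.log (1 + β⁻¹)) :=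
    intermediate_value_Icc hst (hx.time_continuousOn.mono fun u hu => mem_Ici.2 (by
      linarith [hu.1])) ⟨by linarith, by linarith⟩
  have hτ : τ t₁ - τ s = H - Real.log (1 + β⁻¹) := by linarith
  set ε := Real.exp (-H) / β with hε
  set σ := τ t - τ t₁
  have hx₁ : x t₁ ≤ β * (1 - (1 + β) * ε) * m := by
    convert hafter hst₁ using 4
    rw [hτ, neg_sub, sub_eq_add_neg, Real.exp_add, Real.exp_log (by positivity), hε]
    field_simp
    ring
  have hle := hx.le_of_hump hβ hm hlow hH hs hxs hnonneg hst₁ ht₁t hts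
  rw [hτ, sub_sub_cancel, Real.exp_log (by positivity)] at hle
  calc x t ≤ -(β ^ 2 * m) + (x t₁ + β ^ 2 * m + β ^ 2 * m * (1 + β⁻¹) * σ) * Real.exp (-σ) := hle
    _ ≤ -(β ^ 2 * m) + (β * (1 - (1 + β) * ε) * m + β ^ 2 * m + β ^ 2 * m * (1 + β⁻¹) * σ)
          * Real.exp (-σ) := by gcongr
    _ = (β ^ 2 + β) * m * ((σ - ε + 1) * Real.exp (-σ)) - β ^ 2 * m := by field_simp; ring
    _ ≤ (β ^ 2 + β) * m * (Real.exp (σ - ε) * Real.exp (-σ)) - β ^ 2 * m := by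
        gcongr
        exact Real.add_one_le_exp _
    _ = yorkeContraction β H * m := by
        rw [← Real.exp_add, yorkeContraction, ← hε]
        ring_nf

end Hump

theorem le_yorkeContraction_mul (hx : IsYorkeControlled τ x β h₀ T₀) (hβ : 0 < β) {m H s₀ t : ℝ}
    (hm : 0 ≤ m) (hlow : ∀ u, T₀ ≤ u → -m ≤ x u)
    (hH : ∀ r, T₀ + h₀ ≤ r → τ r - τ (r - h₀) ≤ H) (hβH : Real.log (1 + β⁻¹) ≤ H)
    (hs₀ : T₀ + 2 * h₀ ≤ s₀) (hxs₀ : x s₀ = 0) (ht : s₀ ≤ t) :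
    x t ≤ yorkeContraction β H * m := by
  rcases le_or_gt (x t) 0 with hxt | hxt
  · exact hxt.trans (mul_nonneg (yorkeContraction_nonneg hβ hβH) hm)
  have hh₀ := hx.delay_nonneg
  obtain ⟨s, ⟨hs, hst⟩, hxs, hnonneg⟩ := exists_eq_zero_forall_Icc_nonneg ht
    (hx.continuousOn.mono fun u hu => mem_Ici.2 (by linarith [hu.1])) hxs₀ hxt
  have hhump {r : ℝ} (hsr : s ≤ r) (hrt : r ≤ t) (hr : r ≤ s + h₀) :
      x r ≤ yorkeContraction β H * m :=
    hx.le_yorkeContraction_mul_of_hump hβ hm hlow hH hβH (hs₀.trans hs) hxs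
      (fun u hu => hnonneg u ⟨hu.1, hu.2.trans hrt⟩) hsr hr
  rcases le_total t (s + h₀) with hle | hge
  · exact hhump hst le_rfl hle
  · exact (hx.le_of_nonneg (s := s + h₀) (by linarith) hge fun u hu =>
      hnonneg u ⟨by linarith [hu.1], hu.2⟩).trans (hhump (by linarith) hge le_rfl)

theorem eventually_abs_le_yorkeContraction_mul (hx : IsYorkeControlled τ x β h₀ T₀) (hβ : 0 < β)
    {m H : ℝ} (hzero : ∃ᶠ t in atTop, x t = 0)
    (hH : ∀ r, T₀ + h₀ ≤ r → τ r - τ (r - h₀) ≤ H) (hβH : Real.log (1 + β⁻¹) ≤ H)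
    (hbound : ∀ᶠ t in atTop, |x t| ≤ m) :
    ∀ᶠ t in atTop, |x t| ≤ yorkeContraction β H * m := by
  obtain ⟨N, hN⟩ := eventually_atTop.1 (hbound.and (eventually_ge_atTop T₀))
  have hT₀N : T₀ ≤ N := (hN N le_rfl).2
  have hm : 0 ≤ m := (abs_nonneg _).trans (hN N le_rfl).1
  have hHN (r : ℝ) (hr : N + h₀ ≤ r) : τ r - τ (r - h₀) ≤ H := hH r (by linarith)
  obtain ⟨s, hs, hxs⟩ := frequently_atTop.1 hzero (N + 2 * h₀)
  filter_upwards [eventually_ge_atTop s] with t ht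
  refine abs_le'.2 ⟨?_, ?_⟩
  · exact (hx.mono hT₀N).le_yorkeContraction_mul hβ hm (fun u hu => (abs_le.1 (hN u hu).1).1)
      hHN hβH hs hxs ht
  · exact (hx.mono hT₀N).neg.le_yorkeContraction_mul hβ hm
      (fun u hu => neg_le_neg (abs_le.1 (hN u hu).1).2) hHN hβH hs (neg_eq_zero.2 hxs) ht

theorem tendsto_zero (hx : IsYorkeControlled τ x β h₀ T₀) (hβ : 0 < β) {D M : ℝ}
    (hτ : Tendsto τ atTop atTop) (hD : ∀ r, T₀ + h₀ ≤ r → τ r - τ (r - h₀) ≤ D)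
    (hlog : Real.log ((β ^ 2 + β) / (β ^ 2 + 1)) < Real.exp (-D) / β)
    (hbound : ∀ᶠ t in atTop, |x t| ≤ M) : Tendsto x atTop (𝓝 0) := by
  rcases eventually_pos_or_eventually_neg_or_frequently_eq_zero hx.continuousOn
    with hpos | hneg | hzero
  · exact hx.tendsto_zero_of_eventually_nonneg hτ (hpos.mono fun _ => le_of_lt)
  · simpa using (hx.neg.tendsto_zero_of_eventually_nonneg hτ
      (hneg.mono fun _ ht => (neg_pos.2 ht).le)).neg
  · have hβH : Real.log (1 + β⁻¹) ≤ max D (Real.log (1 + β⁻¹)) := le_max_right _ _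
    exact tendsto_zero_of_eventually_norm_le_mul (yorkeContraction_nonneg hβ hβH)
      (yorkeContraction_lt_one hβ (log_lt_exp_neg_max_div hβ hlog)) hbound fun m hm =>
        hx.eventually_abs_le_yorkeContraction_mul hβ hzero
          (fun r hr => (hD r hr).trans (le_max_left _ _)) hβH hm

end IsYorkeControlled

theorem exists_absolutelyContinuousOnInterval_deriv_eq {a : ℝ → ℝ} {α A : ℝ} (T₀ : ℝ)
    (ha : Measurable a) (haI : ∀ t, a t ∈ Icc α A) :
    ∃ τ : ℝ → ℝ, (∀ t, AbsolutelyContinuousOnInterval τ T₀ t) ∧ (∀ᵐ t, deriv τ t = a t) ∧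
      ∀ s t, s ≤ t → τ t - τ s ∈ Icc (α * (t - s)) (A * (t - s)) := by
  have hloc : LocallyIntegrable a volume := (locallyIntegrable_const (max |α| |A|)).mono
    ha.aestronglyMeasurable (.of_forall fun t =>
      (abs_le_max_abs_abs (haI t).1 (haI t).2).trans (le_abs_self _))
  have hint (s t : ℝ) : IntervalIntegrable a volume s t :=
    (hloc.integrableOn_isCompact isCompact_uIcc).intervalIntegrable
  refine ⟨fun t => ∫ r in T₀..t, a r, fun t =>
    (hint T₀ t).absolutelyContinuousOnInterval_intervalIntegral left_mem_uIcc, ?_,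
    fun s t hst => ?_⟩
  · filter_upwards [LocallyIntegrable.ae_hasDerivAt_integral hloc] with t ht using (ht T₀).deriv
  · have hlow := intervalIntegral.integral_mono_on hst intervalIntegrable_const (hint s t)
      fun r _ => (haI r).1
    have hupp := intervalIntegral.integral_mono_on hst (hint s t) intervalIntegrable_const
      fun r _ => (haI r).2
    rw [intervalIntegral.integral_const, smul_eq_mul, mul_comm] at hlow hupp
    rw [intervalIntegral.integral_interval_sub_left (hint T₀ t) (hint T₀ s)]
    exact ⟨hlow, hupp⟩

/-- The Yorke condition `-b sup (-x)⁺ ≤ F t ≤ b sup x⁺` on the delayed term `F` of an equation for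
`x`, the suprema being taken over the memory `[t - h₀, t]`; it is required from the moment on when
the memory lies in `[T₀, ∞)`. -/
def YorkeCondition (F x : ℝ → ℝ) (b h₀ T₀ : ℝ) : Prop :=
  ∀ᵐ t, T₀ + h₀ ≤ t → ∀ c, 0 ≤ c →
    ((∀ u ∈ Icc (t - h₀) t, -c ≤ x u) → -(b * c) ≤ F t) ∧
    ((∀ u ∈ Icc (t - h₀) t, x u ≤ c) → F t ≤ b * c)

theorem IsYorkeControlled.of_ae_deriv_eq {τ x F : ℝ → ℝ} {α b h₀ T₀ : ℝ} (hα : 0 < α)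
    (hb : 0 ≤ b) (hh₀ : 0 ≤ h₀) (hτ_mono : MonotoneOn τ (Ici T₀))
    (hτ : ∀ t, T₀ ≤ t → AbsolutelyContinuousOnInterval τ T₀ t)
    (hτ' : ∀ᵐ t, T₀ + h₀ ≤ t → α ≤ deriv τ t)
    (hx : ∀ t, T₀ ≤ t → AbsolutelyContinuousOnInterval x T₀ t)
    (hx' : ∀ᵐ t, T₀ + h₀ ≤ t → deriv x t = -(deriv τ t * x t) - F t)
    (hF : YorkeCondition F x b h₀ T₀) :
    IsYorkeControlled τ x (b / α) h₀ T₀ := by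
  have hscale {d c : ℝ} (hd : α ≤ d) (hc : 0 ≤ c) : b * c ≤ d * (b / α * c) := by
    calc b * c = α * (b / α * c) := by field_simp
      _ ≤ d * (b / α * c) := by gcongr
  refine ⟨hh₀, hτ_mono, hτ, hx, ?_, ?_⟩
  · filter_upwards [hτ', hx', hF] with t hτt hxt hFt hTt c hc hxc
    linarith [hxt hTt, ((hFt hTt) c hc).1 hxc, hscale (hτt hTt) hc]
  · filter_upwards [hτ', hx', hF] with t hτt hxt hFt hTt c hc hxc
    linarith [hxt hTt, ((hFt hTt) c hc).2 hxc, hscale (hτt hTt) hc]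

theorem tendsto_zero_of_ae_deriv_eq_neg_mul_sub {a x F : ℝ → ℝ} {α A b h₀ T₀ M : ℝ}
    (hα : 0 < α) (hb : 0 < b) (hh₀ : 0 ≤ h₀) (ha : Measurable a) (haI : ∀ t, a t ∈ Icc α A)
    (hx : ∀ t, T₀ ≤ t → AbsolutelyContinuousOnInterval x T₀ t)
    (hx' : ∀ᵐ t, T₀ + h₀ ≤ t → deriv x t = -(a t * x t) - F t)
    (hF : YorkeCondition F x b h₀ T₀)
    (hlog : Real.log ((b ^ 2 + α * b) / (b ^ 2 + α ^ 2)) < α / b * Real.exp (-(A * h₀)))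
    (hbound : ∀ᶠ t in atTop, |x t| ≤ M) : Tendsto x atTop (𝓝 0) := by
  obtain ⟨τ, hτ, hτ', hτ_sub⟩ := exists_absolutelyContinuousOnInterval_deriv_eq T₀ ha haI
  have hτ_mono : Monotone τ := fun s t hst => sub_nonneg.1
    ((mul_nonneg hα.le (sub_nonneg.2 hst)).trans (hτ_sub s t hst).1)
  have hτ_lim : Tendsto τ atTop atTop := by
    refine tendsto_atTop_mono' atTop ?_ (tendsto_atTop_add_const_right atTop (τ 0)
      (tendsto_id.const_mul_atTop hα))
    filter_upwards [eventually_ge_atTop 0] with t ht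
    simpa [le_sub_iff_add_le] using (hτ_sub 0 t ht).1
  have hcontrolled : IsYorkeControlled τ x (b / α) h₀ T₀ := by
    refine .of_ae_deriv_eq hα hb.le hh₀ (hτ_mono.monotoneOn _) (fun t _ => hτ t) ?_ hx ?_ hF
    · filter_upwards [hτ'] with t ht _ using ht ▸ (haI t).1
    · filter_upwards [hτ', hx'] with t ht hxt using ht ▸ hxt
  refine hcontrolled.tendsto_zero (div_pos hb hα) (D := A * h₀) hτ_lim (fun r _ => ?_) ?_ hbound
  · simpa using (hτ_sub (r - h₀) r (sub_le_self r hh₀)).2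
  · convert hlog using 1
    · congr 1
      field_simp
    · field_simp

/-- The sector condition `α ≤ φ u / u ≤ β` for the nonzero arguments `u` in `I`, for a function
with `φ 0 = 0`. -/
structure IsInSector (φ : ℝ → ℝ) (I : Set ℝ) (α β : ℝ) : Prop where
  zero : φ 0 = 0
  div_mem : ∀ u ∈ I, u ≠ 0 → φ u / u ∈ Icc α β

namespace IsInSector

variable {φ : ℝ → ℝ} {I : Set ℝ} {b c : ℝ}

theorem neg {α β : ℝ} (hφ : IsInSector φ I α β) :
    IsInSector (fun u => -φ (-u)) (Neg.neg ⁻¹' I) α β where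
  zero := by simp [hφ.zero]
  div_mem u hu hu₀ := by simpa [neg_div, div_neg] using hφ.div_mem (-u) hu (neg_ne_zero.2 hu₀)

theorem le_mul (hφ : IsInSector φ I 0 b) (hb : 0 ≤ b) (hc : 0 ≤ c) {u : ℝ} (hu : u ∈ I)
    (huc : u ≤ c) : φ u ≤ b * c := by
  rcases lt_trichotomy u 0 with hneg | rfl | hpos
  · have hφu := mul_nonpos_of_nonneg_of_nonpos (hφ.div_mem u hu hneg.ne).1 hneg.le
    rw [div_mul_cancel₀ _ hneg.ne] at hφu
    exact hφu.trans (mul_nonneg hb hc)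
  · exact hφ.zero.trans_le (mul_nonneg hb hc)
  · calc φ u ≤ b * u := (div_le_iff₀ hpos).1 (hφ.div_mem u hu hpos.ne').2
      _ ≤ b * c := by gcongr

end IsInSector

theorem setIntegral_le_of_measure_le_one {Ω : Type*} [MeasurableSpace Ω] {μ : Measure Ω}
    {S : Set Ω} {y : Ω → ℝ} {c : ℝ} (hS : MeasurableSet S) (hμ : μ S ≤ 1) (hc : 0 ≤ c)
    (hy : ∀ s ∈ S, y s ≤ c) : ∫ s in S, y s ∂μ ≤ c := by
  by_cases hint : IntegrableOn y S μ
  · calc ∫ s in S, y s ∂μ ≤ ∫ _ in S, c ∂μ := setIntegral_mono_on hint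
          (integrableOn_const (ne_top_of_le_ne_top ENNReal.one_ne_top hμ)) hS hy
      _ = μ.real S * c := by rw [setIntegral_const, smul_eq_mul]
      _ ≤ c := mul_le_of_le_one_left hc
          (ENNReal.toReal_le_of_le_ofReal zero_le_one (by simpa using hμ))
  · rwa [integral_undef hint]

section DelayedTerm

variable {ι Ω : Type*} [Fintype ι] [MeasurableSpace Ω] {μ : ι → Measure Ω} {S : ι → Set Ω}
  {g : ι → ℝ → ℝ} {I : Set ℝ} {b : ι → ℝ} {x : Ω → ℝ} {c : ℝ}

theorem sum_setIntegral_le_of_isInSector (hS : ∀ k, MeasurableSet (S k))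
    (hμ : ∀ k, μ k (S k) ≤ 1) (hb : ∀ k, 0 ≤ b k) (hc : 0 ≤ c)
    (hg : ∀ k, IsInSector (g k) I 0 (b k)) (hxI : ∀ k, ∀ s ∈ S k, x s ∈ I)
    (hxc : ∀ k, ∀ s ∈ S k, x s ≤ c) :
    ∑ k, ∫ s in S k, g k (x s) ∂μ k ≤ (∑ k, b k) * c := by
  rw [Finset.sum_mul]
  exact Finset.sum_le_sum fun k _ => setIntegral_le_of_measure_le_one (hS k) (hμ k)
    (mul_nonneg (hb k) hc) fun s hs => (hg k).le_mul (hb k) hc (hxI k s hs) (hxc k s hs)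

theorem neg_le_sum_setIntegral_of_isInSector (hS : ∀ k, MeasurableSet (S k))
    (hμ : ∀ k, μ k (S k) ≤ 1) (hb : ∀ k, 0 ≤ b k) (hc : 0 ≤ c)
    (hg : ∀ k, IsInSector (g k) I 0 (b k)) (hxI : ∀ k, ∀ s ∈ S k, x s ∈ I)
    (hxc : ∀ k, ∀ s ∈ S k, -c ≤ x s) :
    -((∑ k, b k) * c) ≤ ∑ k, ∫ s in S k, g k (x s) ∂μ k := by
  have hle := sum_setIntegral_le_of_isInSector hS hμ hb hc (fun k => (hg k).neg)
    (x := fun s => -x s) (by simpa using hxI) fun k s hs => neg_le.1 (hxc k s hs)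
  simp only [neg_neg, integral_neg, Finset.sum_neg_distrib] at hle
  exact neg_le.1 hle

theorem yorkeCondition_sum_setIntegral {g : ι → ℝ → ℝ → ℝ} {h : ι → ℝ → ℝ}
    {μ : ι → ℝ → Measure ℝ} {x : ℝ → ℝ} {h₀ T₀ : ℝ} (hb : ∀ k, 0 ≤ b k)
    (hh₀ : ∀ k t, T₀ + h₀ ≤ t → t - h k t ≤ h₀)
    (hμ : ∀ᵐ t, T₀ + h₀ ≤ t → ∀ k, μ k t (Icc (h k t) t) ≤ 1)
    (hg : ∀ k t, T₀ + h₀ ≤ t → IsInSector (g k t) I 0 (b k)) (hxI : ∀ t, T₀ ≤ t → x t ∈ I) :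
    YorkeCondition (fun t => ∑ k, ∫ s in Icc (h k t) t, g k t (x s) ∂μ k t) x (∑ k, b k)
      h₀ T₀ := by
  filter_upwards [hμ] with t hμt ht c hc
  have hmem (k : ι) (s : ℝ) (hs : s ∈ Icc (h k t) t) : s ∈ Icc (t - h₀) t :=
    ⟨by linarith [hh₀ k t ht, hs.1], hs.2⟩
  have hmemI (k : ι) (s : ℝ) (hs : s ∈ Icc (h k t) t) : x s ∈ I :=
    hxI s (by linarith [(hmem k s hs).1])
  exact ⟨fun hxc => neg_le_sum_setIntegral_of_isInSector (fun _ => measurableSet_Icc) (hμt ht) hb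
      hc (hg · t ht) hmemI fun k s hs => hxc s (hmem k s hs),
    fun hxc => sum_setIntegral_le_of_isInSector (fun _ => measurableSet_Icc) (hμt ht) hb
      hc (hg · t ht) hmemI fun k s hs => hxc s (hmem k s hs)⟩

end DelayedTerm

theorem exists_measurable_coefficient {f : ℝ → ℝ → ℝ} {x : ℝ → ℝ} {I : Set ℝ} {α A T₀ : ℝ}
    (hαA : α ≤ A) (hf : ContinuousOn (fun p : ℝ × ℝ => f p.1 p.2) (Ici T₀ ×ˢ univ))
    (hfI : ∀ t, T₀ ≤ t → IsInSector (f t) I α A) (hx : ContinuousOn x (Ici T₀))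
    (hxI : ∀ t, T₀ ≤ t → x t ∈ I) :
    ∃ a : ℝ → ℝ, Measurable a ∧ (∀ t, a t ∈ Icc α A) ∧ ∀ t, T₀ ≤ t → f t (x t) = a t * x t := by
  classical
  have hmax : Continuous fun t : ℝ => max t T₀ := continuous_id.max continuous_const
  have hmax_mem (t : ℝ) : T₀ ≤ max t T₀ := le_max_right t T₀
  have hxc : Continuous fun t => x (max t T₀) := hx.comp_continuous hmax hmax_mem
  have hfc : Continuous fun t => f (max t T₀) (x (max t T₀)) :=
    hf.comp_continuous (hmax.prodMk hxc) fun t => ⟨hmax_mem t, mem_univ _⟩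
  refine ⟨fun t => if x (max t T₀) = 0 then α else f (max t T₀) (x (max t T₀)) / x (max t T₀),
    .ite (hxc.measurable (measurableSet_singleton 0)) measurable_const
      (hfc.measurable.div hxc.measurable), fun t => ?_, fun t ht => ?_⟩
  · beta_reduce
    split_ifs with hzero
    · exact ⟨le_rfl, hαA⟩
    · exact (hfI _ (hmax_mem t)).div_mem _ (hxI _ (hmax_mem t)) hzero
  · simp only [max_eq_left ht]
    split_ifs with hzero
    · rw [hzero, (hfI t ht).zero, mul_zero]
    · rw [div_mul_cancel₀ _ hzero]

namespace IsSolution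

variable {m : ℕ} {f : ℝ → ℝ → ℝ} {g : Fin m → ℝ → ℝ → ℝ} {h : Fin m → ℝ → ℝ}
  {R : Fin m → ℝ → ℝ → ℝ} {φ x : ℝ → ℝ}

theorem absolutelyContinuousOnInterval (hx : IsSolution f g h R φ x) {s t : ℝ} (hs : 0 ≤ s)
    (hst : s ≤ t) : AbsolutelyContinuousOnInterval x s t := by
  refine (hx.absolutelyContinuous t (hs.trans hst)).mono ?_
  rw [uIcc_of_le hst, uIcc_of_le (hs.trans hst)]
  exact Icc_subset_Icc_left hs

theorem ae_deriv_eq (hx : IsSolution f g h R φ x) :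
    ∀ᵐ t, 0 ≤ t → deriv x t = -f t (x t) -
      ∑ k, ∫ s in Icc (h k t) t, g k t (x s) ∂lebesgueStieltjes (R k t) := by
  filter_upwards [(ae_restrict_iff' measurableSet_Ici).1 hx.equation] with t ht ht₀
  obtain ⟨x', hderiv, heq⟩ := ht ht₀
  rw [hderiv.deriv]
  linarith

theorem tendsto_zero_of_forall_mem {I : Set ℝ} {a₀ A h₀ T₀ M : ℝ} {b : Fin m → ℝ}
    (hx : IsSolution f g h R φ x) (hT₀ : 0 ≤ T₀) (hxI : ∀ t, T₀ ≤ t → x t ∈ I)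
    (hM : ∀ u ∈ I, |u| ≤ M) (hh₀_nonneg : 0 ≤ h₀) (hh₀ : ∀ k t, 0 ≤ t → t - h k t ≤ h₀)
    (hR : ∀ k, ∀ᵐ t ∂(volume.restrict (Ici (0 : ℝ))),
      lebesgueStieltjes (R k t) (Icc (max 0 (h k t)) t) ≤ 1)
    (hf : ContinuousOn (fun p : ℝ × ℝ => f p.1 p.2) (Ici 0 ×ˢ univ))
    (ha₀ : 0 < a₀) (haA : a₀ ≤ A) (hb : ∀ k, 0 ≤ b k) (hb_sum : 0 < ∑ k, b k)
    (hfI : ∀ t, 0 ≤ t → IsInSector (f t) I a₀ A)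
    (hgI : ∀ k t, 0 ≤ t → IsInSector (g k t) I 0 (b k))
    (hlog : Real.log (((∑ k, b k) ^ 2 + a₀ * ∑ k, b k) / ((∑ k, b k) ^ 2 + a₀ ^ 2)) <
      a₀ / (∑ k, b k) * Real.exp (-(A * h₀))) :
    Tendsto x atTop (𝓝 0) := by
  have hac (t : ℝ) (ht : T₀ ≤ t) : AbsolutelyContinuousOnInterval x T₀ t :=
    hx.absolutelyContinuousOnInterval hT₀ ht
  obtain ⟨a, ha_meas, haI, hfa⟩ := exists_measurable_coefficient haA
    (hf.mono (prod_mono_left (Ici_subset_Ici.2 hT₀))) (fun t ht => hfI t (hT₀.trans ht))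
    (continuousOn_Ici_of_absolutelyContinuousOnInterval hac) hxI
  have hmass : ∀ᵐ t, T₀ + h₀ ≤ t → ∀ k, lebesgueStieltjes (R k t) (Icc (h k t) t) ≤ 1 := by
    filter_upwards [(ae_restrict_iff' measurableSet_Ici).1 (ae_all_iff.2 hR)] with t hRt ht k
    have ht₀ : 0 ≤ t := by linarith
    simpa only [max_eq_right (show 0 ≤ h k t by linarith [hh₀ k t ht₀])] using hRt ht₀ k
  refine tendsto_zero_of_ae_deriv_eq_neg_mul_sub ha₀ hb_sum hh₀_nonneg ha_meas haI hac ?_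
    (yorkeCondition_sum_setIntegral hb (fun k t ht => hh₀ k t (by linarith)) hmass
      (fun k t ht => hgI k t (by linarith)) hxI) hlog
    (eventually_atTop.2 ⟨T₀, fun t ht => hM _ (hxI t ht)⟩)
  filter_upwards [hx.ae_deriv_eq] with t hxt ht
  rw [← hfa t (by linarith)]
  exact hxt (by linarith)

end IsSolution

theorem theorem6_general {m : ℕ} {f : ℝ → ℝ → ℝ} {g : Fin m → ℝ → ℝ → ℝ} {h : Fin m → ℝ → ℝ}
    {R : Fin m → ℝ → ℝ → ℝ} {φ x : ℝ → ℝ} {I : Set ℝ} {a₀ A h₀ : ℝ} {b : Fin m → ℝ}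
    (hx : IsSolution f g h R φ x) (hI : Bornology.IsBounded I) (hxI : ∀ᶠ t in atTop, x t ∈ I)
    (hh : ∀ k t, 0 ≤ t → h k t ≤ t) (hh₀ : ∀ k t, 0 ≤ t → t - h k t ≤ h₀)
    (hR : ∀ k, ∀ᵐ t ∂(volume.restrict (Ici (0 : ℝ))), Monotone (R k t) ∧
      lebesgueStieltjes (R k t) (Icc (max 0 (h k t)) t) ≤ 1)
    (hf : ContinuousOn (fun p : ℝ × ℝ => f p.1 p.2) (Ici 0 ×ˢ univ))
    (ha₀ : 0 < a₀) (hb : ∀ k, 0 ≤ b k) (hfI : ∀ t, 0 ≤ t → IsInSector (f t) I a₀ A)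
    (hgI : ∀ k t, 0 ≤ t → IsInSector (g k t) I 0 (b k))
    (hlog : Real.log (((∑ k, b k) ^ 2 + a₀ * ∑ k, b k) / ((∑ k, b k) ^ 2 + a₀ ^ 2)) <
      a₀ / (∑ k, b k) * Real.exp (-(A * h₀))) :
    Tendsto x atTop (𝓝 0) := by
  have hb_sum : 0 < ∑ k, b k := (Finset.sum_nonneg fun k _ => hb k).lt_of_ne' fun hzero => by
    simp [hzero] at hlog
  obtain ⟨k, -, -⟩ := Finset.exists_ne_zero_of_sum_ne_zero hb_sum.ne'
  have hh₀_nonneg : 0 ≤ h₀ := (sub_nonneg.2 (hh k 0 le_rfl)).trans (hh₀ k 0 le_rfl)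
  obtain ⟨T₀, hT₀⟩ := eventually_atTop.1 (hxI.and (eventually_ge_atTop 0))
  rcases le_or_gt a₀ A with haA | hAa
  · obtain ⟨M, hM⟩ := hI.exists_norm_le
    exact hx.tendsto_zero_of_forall_mem (hT₀ T₀ le_rfl).2 (fun t ht => (hT₀ t ht).1) hM hh₀_nonneg
      hh₀ (fun k => (hR k).mono fun _ ht => ht.2) hf ha₀ haA hb hb_sum hfI hgI hlog
  · refine tendsto_const_nhds.congr' (hxI.mono fun t ht => ?_)
    by_contra! hne
    exact hAa.not_ge ((nonempty_Icc (a := a₀) (b := A)).1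
      ⟨_, (hfI 0 le_rfl).div_mem _ ht hne.symm⟩)

theorem theorem6 (m : ℕ) (f : ℝ → ℝ → ℝ) (g : Fin m → ℝ → ℝ → ℝ) (h : Fin m → ℝ → ℝ)
    (R : Fin m → ℝ → ℝ → ℝ)
    (x₁₀ x₂₀ : EReal) (x₁ x₂ : ℝ) (a₀ A h₀ b₀ : ℝ) (b : Fin m → ℝ)
    -- the delays
    (hh : ∀ k, IsDelayedArgument (h k))
    -- the kernels
    (hR : ∀ k, ∀ᵐ t ∂(volume.restrict (Ici (0 : ℝ))), Monotone (R k t) ∧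
      lebesgueStieltjes (R k t) (Icc (max 0 (h k t)) t) ≤ 1)
    -- the nonlinearities
    (hf : IsSignPreserving f) (hg : ∀ k, IsSignPreserving (g k))
    -- unique global solvability and boundedness of the solutions
    (hx₁₀ : x₁₀ ≤ 0) (hx₂₀ : 0 ≤ x₂₀) (hx₁ : x₁ ≤ 0) (hx₂ : 0 ≤ x₂)
    (hsol : ∀ φ : ℝ → ℝ, IsAdmissibleInitial x₁₀ x₂₀ φ →
      (∃! x : ℝ → ℝ, IsSolution f g h R φ x) ∧
      ∀ x : ℝ → ℝ, IsSolution f g h R φ x → ∀ᶠ t in atTop, x₁ ≤ x t ∧ x t ≤ x₂)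
    -- the estimates
    (ha₀ : 0 < a₀) (hA : 0 < A) (hb : ∀ k, 0 < b k)
    (hfb : ∀ t, 0 ≤ t → ∀ u, x₁ ≤ u → u ≤ x₂ → u ≠ 0 → a₀ ≤ f t u / u ∧ f t u / u ≤ A)
    (hgb : ∀ k, ∀ t, 0 ≤ t → ∀ u, x₁ ≤ u → u ≤ x₂ → u ≠ 0 →
      0 ≤ g k t u / u ∧ g k t u / u ≤ b k)
    (hh₀ : ∀ k, ∀ t, 0 ≤ t → t - h k t ≤ h₀)
    (hb₀ : b₀ = ∑ k, b k)
    (hineq : a₀ / b₀ * Real.exp (-(A * h₀)) >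
      Real.log ((b₀ ^ 2 + a₀ * b₀) / (b₀ ^ 2 + a₀ ^ 2))) :
    ∀ φ : ℝ → ℝ, IsAdmissibleInitial x₁₀ x₂₀ φ →
      ∀ x : ℝ → ℝ, IsSolution f g h R φ x → Tendsto x atTop (𝓝 0) := by
  intro φ hφ x hx
  subst hb₀
  exact theorem6_general hx (Metric.isBounded_Icc x₁ x₂) ((hsol φ hφ).2 x hx)
    (fun k => (hh k).le_self) hh₀ hR hf.continuousOn ha₀ (fun k => (hb k).le)
    (fun t ht => ⟨hf.zero t ht, fun u hu => hfb t ht u hu.1 hu.2⟩)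
    (fun k t ht => ⟨(hg k).zero t ht, fun u hu => hgb k t ht u hu.1 hu.2⟩) hineq
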